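/- **Theorem A.** There are universal constants $c, C > 0$ such that the following holds for every finite, undirected, simple graph $G = (V,E)$ with $|V| \ge 2$. Let $\mathcal M(G)$ be the set of transition matrices $P \in [0,1]^{V\times V}$ (all row sums equal to $1$) such that $P(u,v) > 0$ only if $\{u,v\} \in E$ or $u = v$, which are lazy, i.e. $P(v,v) \ge \tfrac12$ for all $v \in V$, and reversible with respect to the uniform distribution $\pi$ on $V$, i.e. $\pi(u)P(u,v) = \pi(v)P(v,u)$ for all $u,v \in V$. For $P \in \mathcal M(G)$ let $\lambda_P$ be its second largest eigenvalue, counted with multiplicity (the largest one being $1$), and let $\gamma_P = 1 - \lambda_P$ be its spectral gap. Let $\gamma^\star(G) = \max_{P \in \mathcal M(G)} \gamma_P$ be the optimal spectral gap; this maximum is attained. Let $$\Psi^\star(G) = \min_{S \subseteq V,\ 0 < |S| \le |V|/2} \frac{|\partial S|}{|S|}, \qquad \partial S = \{ y \in V \setminus S : \{x,y\} \in E \text{ for some } x \in S \},$$ be the vertex conductance. Then $$ c\,\frac{\Psi^\star(G)^2}{\log |V|} \;\le\; \gamma^\star(G) \;\le\; C\,\Psi^\star(G). $$ Consequently, vertex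 conductance characterises fast mixing: for every family $(G_i)_{i \in I}$ of finite graphs $G_i = (V_i, E_i)$, $1/\gamma^\star(G_i)$ is asymptotically polylogarithmic in $|V_i|$ if and only if $1/\Psi^\star(G_i)$ is. Here, for $x_i \in \mathbb R$, "$1/x_i$ is asymptotically polylogarithmic in $|V_i|$" means that there are $K \in \mathbb R$ and $k, n_0 \in \mathbb N$ such that $x_i > 0$ and $1/x_i \le K (\log |V_i|)^k$ for all $i \in I$ with $|V_i| \ge n_0$. -/

import Mathlib

universe u v

noncomputable section

namespace FastestMixing

open Finset

variable {V : Type u} [Fintype V] [DecidableEq V]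

/-- The uniform probability mass function on `V`. -/
def unif (V : Type u) [Fintype V] : V → ℝ := fun _ => 1 / (Fintype.card V : ℝ)

/-- `P` is reversible with respect to `π`: the detailed balance equations hold. -/
def IsReversible (P : Matrix V V ℝ) (π : V → ℝ) : Prop :=
  ∀ x y : V, π x * P x y = π y * P y x

/-- `P` is a transition matrix on the graph `G`: it is stochastic (nonnegative entries, all row
sums equal to one), and off the diagonal it is positive only across edges of `G`. -/
def IsTransitionMatrixOn (G : SimpleGraph V) (P : Matrix V V ℝ) : Prop :=
  P ∈ Matrix.rowStochastic ℝ V ∧ ∀ x y : V, 0 < P x y → G.Adj x y ∨ x = y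

/-- `P` is lazy: every holding probability is at least `1/2`. -/
def IsLazy (P : Matrix V V ℝ) : Prop := ∀ x : V, 1 / 2 ≤ P x x

/-- The set of lazy transition matrices on `G` that are reversible with respect to `π`. -/
def chains (G : SimpleGraph V) (π : V → ℝ) : Set (Matrix V V ℝ) :=
  {P | IsTransitionMatrixOn G P ∧ IsLazy P ∧ IsReversible P π}

/-- The spectral gap `1 - λ_P` of a reversible transition matrix `P`, where `λ_P` is the largest
eigenvalue that remains after one copy of the trivial eigenvalue `1` is removed from the multiset
of eigenvalues of `P`. So the eigenvalues are counted with multiplicity, and the gap of a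
reducible chain is `0`. -/
def spectralGap (P : Matrix V V ℝ) : ℝ :=
  1 - sSup {x : ℝ | x ∈ P.charpoly.roots.erase 1}

/-- The optimal spectral gap of `G`: the largest spectral gap of a lazy chain on `G` that is
reversible with respect to the uniform distribution. -/
def optimalSpectralGap (G : SimpleGraph V) : ℝ :=
  sSup (spectralGap '' chains G (unif V))

open Classical in
/-- The vertex boundary of `S`: the vertices outside `S` with a neighbour in `S`. -/
def vertexBoundary (G : SimpleGraph V) (S : Finset V) : Finset V :=
  {y | y ∉ S ∧ ∃ x ∈ S, G.Adj x y}

/-- The vertex conductance `|∂S| / |S|` of a set of vertices. -/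
def setVertexConductance (G : SimpleGraph V) (S : Finset V) : ℝ :=
  (#(vertexBoundary G S) : ℝ) / (#S : ℝ)

/-- The vertex conductance of `G`: the minimum of `|∂S| / |S|` over the sets `S` of vertices with
`0 < |S| ≤ |V| / 2` (there are finitely many, and at least one if `|V| ≥ 2`). -/
def vertexConductance (G : SimpleGraph V) : ℝ :=
  sInf (setVertexConductance G '' {S : Finset V | 0 < #S ∧ (#S : ℝ) ≤ (Fintype.card V : ℝ) / 2})

/-- For a family of sizes `n i` and numbers `x i`: the numbers `1 / x i` are (finite and)
polylogarithmic in `n i`, asymptotically. -/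
def InvPolylog {ι : Type v} (n : ι → ℕ) (x : ι → ℝ) : Prop :=
  ∃ (C : ℝ) (k n₀ : ℕ), ∀ i : ι, n₀ ≤ n i →
    0 < x i ∧ 1 / x i ≤ C * Real.log (n i : ℝ) ^ k

/-- A family of graphs admits fast mixing chains: the optimal relaxation times are polylogarithmic
in the number of vertices, asymptotically. -/
def AdmitsFastMixing {ι : Type v} (V : ι → Type u) [∀ i, Fintype (V i)]
    [∀ i, DecidableEq (V i)] (G : ∀ i, SimpleGraph (V i)) : Prop :=
  InvPolylog (fun i => Fintype.card (V i)) (fun i => optimalSpectralGap (G i))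

end FastestMixing

end

/-! Upper bound: test the Poincaré inequality on the indicator of `S`. By laziness each boundary
vertex sends mass at most 1/2 into `S`, so the energy is at most |∂S|/2, while the centred square
sum is at least |S|/2. Hence γ* ≤ Ψ*.

Lower bound: by minimax duality (`exists_chain_of_forall_test`) the chain may be chosen after the
test function, at the price of vector-valued test functions b. Given b, walk lazily along a matching
σ of maximal weight for the weights |b x - b y|² (`exists_dominating_matching`). Maximality gives |b
x - b y|² ≤ g x + g y on every edge, where g x = |b x - b (σ x)|², and the sum of g is four times
the energy. What remains is a Cheeger inequality bounding the variance of b by the sum of g.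

For scalar f (`sq_vertexConductance_mul_centeredSq_le`) there is no logarithm: the vertices z with
|f z - t| ≤ √(g z) separate the level set {f > t} from its complement, and one integrates over
levels. Vectors are projected to the line by random signs
(`sq_vertexConductance_mul_sum_centeredSq_le`); controlling the subgaussian increments to all
neighbours of a vertex at once costs the factor log |V|. -/

section

open Finset Matrix

noncomputable section

namespace FastestMixing

/-! ### Spectral gap as the best Poincaré constant -/

section

variable {V : Type*} [Fintype V]

/-- The mean of `f` over `V`. -/
def mean (f : V → ℝ) : ℝ := (∑ x, f x) / (Fintype.card V : ℝ)

/-- The sum of squared deviations of `f` from its mean. -/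
def centeredSq (f : V → ℝ) : ℝ := ∑ x, (f x - mean f) ^ 2

/-- The (unnormalised) Dirichlet form of `P`. -/
def energy (P : Matrix V V ℝ) (f : V → ℝ) : ℝ :=
  1 / 2 * ∑ x, ∑ y, P x y * (f x - f y) ^ 2

lemma sum_sub_mean [Nonempty V] (f : V → ℝ) : ∑ x, (f x - mean f) = 0 := by
  have : (Fintype.card V : ℝ) ≠ 0 := by simp
  simp only [sum_sub_distrib, sum_const, card_univ, nsmul_eq_mul, mean]
  field_simp
  ring

lemma centeredSq_eq_of_sum_eq_zero {f : V → ℝ} (h : ∑ x, f x = 0) :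
    centeredSq f = ∑ x, f x ^ 2 := by
  simp [centeredSq, mean, h]

lemma sum_sub_sq_eq [Nonempty V] (f : V → ℝ) (m : ℝ) :
    ∑ x, (f x - m) ^ 2 = centeredSq f + Fintype.card V * (mean f - m) ^ 2 := by
  have h : ∀ x, (f x - m) ^ 2
      = (f x - mean f) ^ 2 + 2 * (mean f - m) * (f x - mean f) + (mean f - m) ^ 2 := by
    intro x; ring
  simp only [h, sum_add_distrib, ← mul_sum, sum_sub_mean, sum_const, card_univ, nsmul_eq_mul,
    centeredSq]
  ring

lemma centeredSq_le [Nonempty V] (f : V → ℝ) (m : ℝ) :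
    centeredSq f ≤ ∑ x, (f x - m) ^ 2 := by
  rw [sum_sub_sq_eq]
  have : (0 : ℝ) ≤ Fintype.card V * (mean f - m) ^ 2 := by positivity
  linarith

lemma energy_sub_const (P : Matrix V V ℝ) (f : V → ℝ) (m : ℝ) :
    energy P (fun x => f x - m) = energy P f := by
  simp [energy]

variable [DecidableEq V]

lemma energy_nonneg {P : Matrix V V ℝ} (hP : P ∈ rowStochastic ℝ V) (f : V → ℝ) :
    0 ≤ energy P f := by
  have h := (mem_rowStochastic.1 hP).1
  exact mul_nonneg (by norm_num)
    (sum_nonneg fun x _ => sum_nonneg fun y _ => mul_nonneg (h x y) (sq_nonneg _))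

lemma sum_row_eq_one {P : Matrix V V ℝ} (hP : P ∈ rowStochastic ℝ V) (x : V) :
    ∑ y, P x y = 1 := by
  have h := congrFun (mem_rowStochastic.1 hP).2 x
  simpa [mulVec, dotProduct] using h

lemma energy_eq {P : Matrix V V ℝ} (hP : P ∈ rowStochastic ℝ V) (hs : P.IsSymm) (f : V → ℝ) :
    energy P f = f ⬝ᵥ f - f ⬝ᵥ (P *ᵥ f) := by
  have h1 : ∑ x, ∑ y, P x y * f x ^ 2 = f ⬝ᵥ f := by
    simp only [← sum_mul, sum_row_eq_one hP, one_mul, dotProduct, sq]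
  have h2 : ∑ x, ∑ y, P x y * f y ^ 2 = f ⬝ᵥ f := by
    rw [← h1, sum_comm]
    simp only [hs.apply]
  have h3 : ∑ x, ∑ y, P x y * (f x * f y) = f ⬝ᵥ (P *ᵥ f) := by
    simp only [dotProduct, mulVec, mul_sum]
    exact sum_congr rfl fun x _ => sum_congr rfl fun y _ => by ring
  have h4 : ∀ x y, P x y * (f x - f y) ^ 2
      = P x y * f x ^ 2 + P x y * f y ^ 2 - 2 * (P x y * (f x * f y)) := by
    intro x y; ring
  simp only [energy, h4, sum_sub_distrib, sum_add_distrib, ← mul_sum, h1, h2, h3]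
  ring

omit [DecidableEq V] in
lemma isSymm_of_isReversible_unif [Nonempty V] {P : Matrix V V ℝ} (h : IsReversible P (unif V)) :
    P.IsSymm := by
  ext x y
  have := h y x
  have hc : (Fintype.card V : ℝ) ≠ 0 := by simp
  simp only [unif] at this
  field_simp at this
  simpa using this

omit [DecidableEq V] in
lemma isReversible_unif_of_isSymm {P : Matrix V V ℝ} (h : P.IsSymm) : IsReversible P (unif V) :=
  fun x y => by simp [unif, h.apply]

/-- A real symmetric matrix has an orthonormal basis of eigenvectors, indexed compatibly with the
roots of the characteristic polynomial. -/
lemma exists_eigenbasis {P : Matrix V V ℝ} (hs : P.IsSymm) :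
    ∃ (e : V → ℝ) (v : V → V → ℝ), P.charpoly.roots = Multiset.map e univ.val ∧
      (∀ i, P *ᵥ v i = e i • v i) ∧ (∀ i j, v i ⬝ᵥ v j = if i = j then 1 else 0) ∧
      ∀ f g : V → ℝ, ∑ i, (v i ⬝ᵥ f) * (v i ⬝ᵥ g) = f ⬝ᵥ g := by
  have hH : P.IsHermitian := by
    rw [IsHermitian, conjTranspose_eq_transpose_of_trivial]; exact hs
  refine ⟨hH.eigenvalues, fun i => (hH.eigenvectorBasis i).ofLp, ?_, ?_, ?_, ?_⟩
  · rw [hH.roots_charpoly_eq_eigenvalues]; rfl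
  · exact hH.mulVec_eigenvectorBasis
  · intro i j
    have := (orthonormal_iff_ite.1 hH.eigenvectorBasis.orthonormal) i j
    rw [EuclideanSpace.inner_eq_star_dotProduct] at this
    simpa [dotProduct_comm] using this
  · intro f g
    have := hH.eigenvectorBasis.sum_inner_mul_inner (WithLp.toLp 2 f) (WithLp.toLp 2 g)
    simp only [EuclideanSpace.inner_eq_star_dotProduct, star_trivial] at this
    rw [dotProduct_comm f g, ← this]
    exact sum_congr rfl fun i _ => by rw [dotProduct_comm g]

/-- The variational characterisation of the spectral gap. -/
theorem le_spectralGap_iff (hV : 2 ≤ Fintype.card V) {P : Matrix V V ℝ}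
    (hP : P ∈ rowStochastic ℝ V) (hs : P.IsSymm) (γ : ℝ) :
    γ ≤ spectralGap P ↔ ∀ f : V → ℝ, γ * centeredSq f ≤ energy P f := by
  have hne : Nonempty V := Fintype.card_pos_iff.1 (by omega)
  obtain ⟨e, v, hroots, hev, horth, hpars⟩ := exists_eigenbasis hs
  have hsw : ∀ f g : V → ℝ, f ⬝ᵥ (P *ᵥ g) = (P *ᵥ f) ⬝ᵥ g := by
    intro f g
    rw [dotProduct_mulVec, ← mulVec_transpose, hs.eq]
  have henergy : ∀ f, energy P f = ∑ i, (1 - e i) * (v i ⬝ᵥ f) ^ 2 := by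
    intro f
    rw [energy_eq hP hs, ← hpars f f, ← hpars f (P *ᵥ f), ← sum_sub_distrib]
    refine sum_congr rfl fun i _ => ?_
    rw [hsw, hev, smul_dotProduct, smul_eq_mul]; ring
  have hsq : ∀ f : V → ℝ, ∑ x, f x ^ 2 = ∑ i, (v i ⬝ᵥ f) ^ 2 := by
    intro f
    have := hpars f f
    simp only [← sq] at this
    rw [this]; simp [dotProduct, sq]
  have he1 : ∀ i, e i ≤ 1 := by
    intro i
    have h := energy_nonneg hP (v i)
    rw [henergy, sum_eq_single i] at h
    · simpa [horth] using h
    · intro j _ hj; simp [horth, hj]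
    · simp
  have hone : P *ᵥ (1 : V → ℝ) = 1 := (mem_rowStochastic.1 hP).2
  have h1v : ∀ i, (1 - e i) * (v i ⬝ᵥ 1) = 0 := by
    intro i
    have := hsw (v i) 1
    rw [hone, hev, smul_dotProduct, smul_eq_mul] at this
    linarith
  have hcard : ∑ i, (v i ⬝ᵥ (1 : V → ℝ)) ^ 2 = Fintype.card V := by
    rw [← hsq]; simp
  -- If the eigenvalue 1 is multiple, the constant function need not be in the basis. Any basis
  -- vector not orthogonal to it has eigenvalue 1, and its index can play the role of the erased
  -- root.
  obtain ⟨i₀, hi₀⟩ : ∃ i, v i ⬝ᵥ (1 : V → ℝ) ≠ 0 := by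
    by_contra! h
    simp only [h, ne_eq, OfNat.ofNat_ne_zero, not_false_eq_true, zero_pow, sum_const_zero] at hcard
    have : Fintype.card V = 0 := by exact_mod_cast hcard.symm
    omega
  have hei₀ : e i₀ = 1 := by
    rcases mul_eq_zero.1 (h1v i₀) with h | h
    · linarith
    · exact absurd h hi₀
  have hset : {x : ℝ | x ∈ P.charpoly.roots.erase 1} = e '' {i | i ≠ i₀} := by
    have hc : (univ : Finset V).val = i₀ ::ₘ (univ.erase i₀).val := by
      rw [erase_val, Multiset.cons_erase (mem_univ_val _)]
    rw [hroots, hc, Multiset.map_cons, hei₀, Multiset.erase_cons_head]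
    ext x
    simp only [Set.mem_ofPred_eq, Multiset.mem_map, mem_val, mem_erase, mem_univ, and_true,
      Set.mem_image]
  have hbdd : BddAbove (e '' {i | i ≠ i₀}) := ⟨1, by rintro _ ⟨i, _, rfl⟩; exact he1 i⟩
  have hnes : (e '' {i | i ≠ i₀}).Nonempty := by
    obtain ⟨j, hj⟩ := Fintype.exists_ne_of_one_lt_card (by omega) i₀
    exact ⟨e j, j, hj, rfl⟩
  have hgap : γ ≤ spectralGap P ↔ ∀ i, i ≠ i₀ → e i ≤ 1 - γ := by
    rw [spectralGap, hset, le_sub_comm, csSup_le_iff hbdd hnes]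
    simp
  rw [hgap]
  constructor
  · intro h f
    rw [← energy_sub_const P f (mean f), henergy]
    set g : V → ℝ := fun x => f x - mean f with hg
    have hg1 : (1 : V → ℝ) ⬝ᵥ g = 0 := by
      rw [one_dotProduct]; exact sum_sub_mean f
    have hc : centeredSq f = ∑ i, (v i ⬝ᵥ g) ^ 2 := by
      rw [← hsq]; rfl
    rw [hc, mul_sum]
    refine sum_le_sum fun i _ => ?_
    by_cases hi : i = i₀
    · subst hi
      rw [hei₀]
      -- For γ > 0 all other eigenvalues are below 1, so their eigenvectors are orthogonal to
      -- constants; thus `v i₀` spans the constants and is orthogonal to `g`.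
      rcases le_or_gt γ 0 with hγ | hγ
      · nlinarith [sq_nonneg (v i ⬝ᵥ g)]
      · have hz : ∀ j, j ≠ i → v j ⬝ᵥ (1 : V → ℝ) = 0 := by
          intro j hj
          rcases mul_eq_zero.1 (h1v j) with h0 | h0
          · linarith [h j hj]
          · exact h0
        have := hpars 1 g
        rw [hg1, sum_eq_single i (fun j _ hj => by rw [hz j hj, zero_mul]) (by simp)] at this
        rw [(mul_eq_zero.1 this).resolve_left hi₀]
        simp
    · have := h i hi
      nlinarith [sq_nonneg (v i ⬝ᵥ g)]
  · intro h i hi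
    -- The combination of `v i` and `v i₀` with mean zero. Its `v i`-coefficient `a` is nonzero by
    -- the choice of `i₀`.
    set a := v i₀ ⬝ᵥ (1 : V → ℝ)
    set b := -(v i ⬝ᵥ (1 : V → ℝ))
    have hsum : ∑ x, (a • v i + b • v i₀) x = 0 := by
      have : ∑ x, (a • v i + b • v i₀) x = (a • v i + b • v i₀) ⬝ᵥ 1 := by simp [dotProduct]
      rw [this, add_dotProduct, smul_dotProduct, smul_dotProduct]
      simp only [a, b, smul_eq_mul]; ring
    have hdot : ∀ j, v j ⬝ᵥ (a • v i + b • v i₀)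
        = a * (if j = i then 1 else 0) + b * (if j = i₀ then 1 else 0) := by
      intro j
      rw [dotProduct_add, dotProduct_smul, dotProduct_smul, horth, horth]; rfl
    have h' := h (a • v i + b • v i₀)
    rw [centeredSq_eq_of_sum_eq_zero hsum, hsq, henergy] at h'
    have e1 : ∑ j, (v j ⬝ᵥ (a • v i + b • v i₀)) ^ 2 = a ^ 2 + b ^ 2 := by
      have : ∀ j, (v j ⬝ᵥ (a • v i + b • v i₀)) ^ 2
          = (if j = i then a ^ 2 else 0) + (if j = i₀ then b ^ 2 else 0) := by
        intro j
        rw [hdot]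
        by_cases h1 : j = i
        · subst h1; simp [hi]
        · by_cases h2 : j = i₀ <;> simp [h1, h2, Ne.symm hi]
      rw [sum_congr rfl fun j _ => this j]
      simp [sum_add_distrib]
    have e2 : ∑ j, (1 - e j) * (v j ⬝ᵥ (a • v i + b • v i₀)) ^ 2 = (1 - e i) * a ^ 2 := by
      rw [sum_eq_single i]
      · rw [hdot]; simp [hi]
      · intro j _ hj
        rw [hdot]
        by_cases h2 : j = i₀
        · simp [h2, hei₀]
        · simp [hj, h2]
      · simp
    rw [e1, e2] at h'
    have ha : 0 < a ^ 2 := by positivity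
    by_contra hlt
    push Not at hlt
    have := he1 i
    nlinarith [sq_nonneg b]

end

/-! ### Polytope of chains, upper bound and attainment -/

section

variable {V : Type*} [Fintype V] [DecidableEq V]

lemma mem_chains_unif_iff [Nonempty V] {G : SimpleGraph V} {P : Matrix V V ℝ} :
    P ∈ chains G (unif V) ↔ (∀ x y, 0 ≤ P x y) ∧ (∀ x, ∑ y, P x y = 1) ∧
      (∀ x y, x ≠ y → ¬ G.Adj x y → P x y = 0) ∧ (∀ x, 1 / 2 ≤ P x x) ∧
      ∀ x y, P x y = P y x := by
  constructor
  · rintro ⟨⟨h1, h2⟩, h3, h4⟩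
    refine ⟨(mem_rowStochastic.1 h1).1, sum_row_eq_one h1, fun x y hxy hG => ?_, h3, fun x y =>
      (isSymm_of_isReversible_unif h4).apply y x⟩
    by_contra hne
    rcases h2 x y (lt_of_le_of_ne ((mem_rowStochastic.1 h1).1 x y) (Ne.symm hne)) with h | h
    · exact hG h
    · exact hxy h
  · rintro ⟨h1, h2, h3, h4, h5⟩
    refine ⟨⟨mem_rowStochastic.2 ⟨h1, ?_⟩, fun x y hxy => ?_⟩, h4,
      isReversible_unif_of_isSymm (IsSymm.ext fun x y => h5 y x)⟩
    · ext x; simpa [mulVec, dotProduct] using h2 x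
    · by_contra! h
      exact hxy.ne' (h3 x y h.2 h.1)

lemma convex_chains_unif [Nonempty V] (G : SimpleGraph V) : Convex ℝ (chains G (unif V)) := by
  intro P hP Q hQ a b ha hb hab
  rw [mem_chains_unif_iff] at *
  obtain ⟨p1, p2, p3, p4, p5⟩ := hP
  obtain ⟨q1, q2, q3, q4, q5⟩ := hQ
  simp only [Matrix.add_apply, Matrix.smul_apply, smul_eq_mul]
  refine ⟨fun x y => ?_, fun x => ?_, fun x y h h' => ?_, fun x => ?_, fun x y => ?_⟩
  · have := p1 x y; have := q1 x y; positivity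
  · rw [sum_add_distrib, ← mul_sum, ← mul_sum, p2, q2]; linarith
  · rw [p3 x y h h', q3 x y h h']; ring
  · nlinarith [p4 x, q4 x]
  · rw [p5, q5]

lemma isCompact_chains_unif [Nonempty V] (G : SimpleGraph V) :
    IsCompact (chains G (unif V)) := by
  have hK : IsCompact (Set.univ.pi fun _ : V => Set.univ.pi fun _ : V => Set.Icc (0 : ℝ) 1) :=
    isCompact_univ_pi fun _ => isCompact_univ_pi fun _ => isCompact_Icc
  refine IsCompact.of_isClosed_subset hK ?_ ?_
  · have : chains G (unif V) = {P : Matrix V V ℝ | (∀ x y, 0 ≤ P x y) ∧ (∀ x, ∑ y, P x y = 1) ∧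
      (∀ x y, x ≠ y → ¬ G.Adj x y → P x y = 0) ∧ (∀ x, 1 / 2 ≤ P x x) ∧
      ∀ x y, P x y = P y x} := by
      ext P; exact mem_chains_unif_iff
    rw [this]
    simp only [Set.ofPred_and, Set.ofPred_forall]
    have hc : ∀ x y : V, Continuous fun P : Matrix V V ℝ => P x y := fun x y => by fun_prop
    refine IsClosed.inter ?_ (IsClosed.inter ?_ (IsClosed.inter ?_ (IsClosed.inter ?_ ?_)))
    · exact isClosed_iInter fun x => isClosed_iInter fun y => isClosed_le continuous_const (hc x y)
    · exact isClosed_iInter fun x =>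
        isClosed_eq (continuous_finsetSum _ fun y _ => hc x y) continuous_const
    · exact isClosed_iInter fun x => isClosed_iInter fun y => isClosed_iInter fun _ =>
        isClosed_iInter fun _ => isClosed_eq (hc x y) continuous_const
    · exact isClosed_iInter fun x => isClosed_le continuous_const (hc x x)
    · exact isClosed_iInter fun x => isClosed_iInter fun y => isClosed_eq (hc x y) (hc y x)
  · intro P hP
    obtain ⟨p1, p2, -⟩ := mem_chains_unif_iff.1 hP
    intro x _ y _
    refine ⟨p1 x y, ?_⟩
    rw [← p2 x]
    exact single_le_sum (f := fun y => P x y) (fun z _ => p1 x z) (mem_univ y)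

lemma one_mem_chains_unif [Nonempty V] (G : SimpleGraph V) :
    (1 : Matrix V V ℝ) ∈ chains G (unif V) := by
  rw [mem_chains_unif_iff]
  refine ⟨fun x y => ?_, fun x => ?_, fun x y h _ => one_apply_ne h, fun x => ?_, fun x y => ?_⟩
  · rw [one_apply]; split_ifs <;> norm_num
  · simp [one_apply]
  · rw [one_apply_eq]; norm_num
  · simp only [one_apply, eq_comm]

lemma le_spectralGap_iff_of_mem_chains (hV : 2 ≤ Fintype.card V) {G : SimpleGraph V}
    {P : Matrix V V ℝ} (hP : P ∈ chains G (unif V)) (γ : ℝ) :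
    γ ≤ spectralGap P ↔ ∀ f : V → ℝ, γ * centeredSq f ≤ energy P f :=
  have : Nonempty V := Fintype.card_pos_iff.1 (by omega)
  le_spectralGap_iff hV hP.1.1 (isSymm_of_isReversible_unif hP.2.2) γ

lemma centeredSq_indicator [Nonempty V] (S : Finset V) :
    centeredSq (fun x => if x ∈ S then (1 : ℝ) else 0)
      = #S - (#S : ℝ) ^ 2 / Fintype.card V := by
  have hc : (Fintype.card V : ℝ) ≠ 0 := by simp
  have h := sum_sub_sq_eq (fun x => if x ∈ S then (1 : ℝ) else 0) 0
  have hm : mean (fun x => if x ∈ S then (1 : ℝ) else 0) = #S / Fintype.card V := by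
    simp [mean]
  have hs : ∑ x, ((if x ∈ S then (1 : ℝ) else 0) - 0) ^ 2 = (#S : ℝ) := by
    simp
  rw [hs, hm] at h
  field_simp at h ⊢
  linarith

/-- Only transitions from a boundary vertex into `S` count, by symmetry, and such a vertex leaves
with probability at most 1/2. -/
lemma energy_indicator_le [Nonempty V] {G : SimpleGraph V} {P : Matrix V V ℝ}
    (hP : P ∈ chains G (unif V)) (S : Finset V) :
    energy P (fun x => if x ∈ S then (1 : ℝ) else 0) ≤ #(vertexBoundary G S) / 2 := by
  obtain ⟨p1, p2, p3, p4, p5⟩ := mem_chains_unif_iff.1 hP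
  set F : V → V → ℝ := fun x y => if x ∉ S ∧ y ∈ S then P x y else 0 with hF
  have h1 : ∀ x y, P x y * ((if x ∈ S then (1 : ℝ) else 0) - (if y ∈ S then (1 : ℝ) else 0)) ^ 2
      = F x y + F y x := by
    intro x y
    by_cases hx : x ∈ S <;> by_cases hy : y ∈ S <;> simp [hF, hx, hy, p5 x y]
  have h2 : energy P (fun x => if x ∈ S then (1 : ℝ) else 0) = ∑ x, ∑ y, F x y := by
    rw [energy]
    simp only [h1, sum_add_distrib]
    rw [sum_comm (f := fun x y => F y x)]
    ring
  rw [h2]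
  have h3 : ∀ x, ∑ y, F x y ≤ if x ∈ vertexBoundary G S then 1 / 2 else 0 := by
    intro x
    by_cases hx : x ∈ vertexBoundary G S
    · rw [if_pos hx]
      have hxS : x ∉ S := by simp [vertexBoundary] at hx; exact hx.1
      have h4 : ∑ y ∈ univ.erase x, P x y ≤ 1 / 2 := by
        have := add_sum_erase univ (fun y => P x y) (mem_univ x)
        rw [p2] at this
        linarith [p4 x]
      refine le_trans ?_ h4
      rw [← add_sum_erase univ _ (mem_univ x)]
      have : F x x = 0 := by simp [hF]
      rw [this, zero_add]
      refine sum_le_sum fun y _ => ?_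
      simp only [hF]
      split_ifs
      · exact le_rfl
      · exact p1 x y
    · rw [if_neg hx]
      refine (sum_eq_zero fun y _ => ?_).le
      simp only [hF]
      split_ifs with h
      · refine p3 x y ?_ fun hadj => hx ?_
        · rintro rfl; exact h.1 h.2
        · simp only [vertexBoundary, mem_filter, mem_univ, true_and]
          exact ⟨h.1, y, h.2, hadj.symm⟩
      · rfl
  refine (sum_le_sum fun x _ => h3 x).trans ?_
  simp only [sum_ite_mem, univ_inter, sum_const, nsmul_eq_mul]
  linarith

lemma finite_setVertexConductance (G : SimpleGraph V) :
    (setVertexConductance G ''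
      {S : Finset V | 0 < #S ∧ (#S : ℝ) ≤ (Fintype.card V : ℝ) / 2}).Finite :=
  (Set.toFinite _).image _

/-- The division-free form also covers the empty set, which occurs when `W` is removed from a
superlevel set. -/
lemma vertexConductance_mul_le (G : SimpleGraph V) {S : Finset V}
    (hS : 2 * #S ≤ Fintype.card V) :
    vertexConductance G * #S ≤ #(vertexBoundary G S) := by
  rcases Nat.eq_zero_or_pos #S with h | h
  · simp [h]
  · have h2 : (#S : ℝ) ≤ (Fintype.card V : ℝ) / 2 := by
      rw [le_div_iff₀ (by norm_num)]; exact_mod_cast (by omega : #S * 2 ≤ Fintype.card V)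
    have := csInf_le (finite_setVertexConductance G).bddBelow ⟨S, ⟨h, h2⟩, rfl⟩
    rwa [setVertexConductance, le_div_iff₀ (by exact_mod_cast h)] at this

lemma exists_card_eq_half (V : Type*) [Fintype V] :
    ∃ S : Finset V, #S = Fintype.card V / 2 := by
  obtain ⟨S, _, hS⟩ := exists_subset_card_eq (s := (univ : Finset V)) (n := Fintype.card V / 2)
    (by rw [card_univ]; omega)
  exact ⟨S, hS⟩

lemma vertexConductance_nonneg (G : SimpleGraph V) : 0 ≤ vertexConductance G := by
  apply Real.sInf_nonneg
  rintro _ ⟨S, -, rfl⟩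
  rw [setVertexConductance]; positivity

lemma vertexConductance_le_two (hV : 2 ≤ Fintype.card V) (G : SimpleGraph V) :
    vertexConductance G ≤ 2 := by
  obtain ⟨S, hS⟩ := exists_card_eq_half V
  have h1 := vertexConductance_mul_le G (S := S) (by omega)
  have h2 : #(vertexBoundary G S) ≤ 2 * #S := by
    have h3 : vertexBoundary G S ⊆ Sᶜ := by
      intro y hy
      simp only [vertexBoundary, mem_filter, mem_univ, true_and] at hy
      simpa using hy.1
    have := card_le_card h3
    rw [card_compl] at this
    omega
  have h4 : (#(vertexBoundary G S) : ℝ) ≤ 2 * #S := by exact_mod_cast h2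
  have h5 : (0 : ℝ) < #S := by exact_mod_cast (by omega : 0 < #S)
  nlinarith

/-- The spectral gap of a lazy chain is at most the vertex conductance. -/
theorem spectralGap_le_vertexConductance (hV : 2 ≤ Fintype.card V) {G : SimpleGraph V}
    {P : Matrix V V ℝ} (hP : P ∈ chains G (unif V)) :
    spectralGap P ≤ vertexConductance G := by
  have hne : Nonempty V := Fintype.card_pos_iff.1 (by omega)
  have h0 : 0 ≤ spectralGap P := (le_spectralGap_iff_of_mem_chains hV hP 0).2 fun f => by
    rw [zero_mul]; exact energy_nonneg hP.1.1 f
  refine le_csInf ?_ ?_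
  · obtain ⟨S, hS⟩ := exists_card_eq_half V
    refine ⟨_, S, ⟨by omega, ?_⟩, rfl⟩
    rw [le_div_iff₀ (by norm_num)]; exact_mod_cast (by omega : #S * 2 ≤ Fintype.card V)
  · rintro _ ⟨S, ⟨hS0, hS⟩, rfl⟩
    have h := (le_spectralGap_iff_of_mem_chains hV hP _).1 le_rfl
      (fun x => if x ∈ S then (1 : ℝ) else 0)
    have h' := h.trans (energy_indicator_le hP S)
    have hs : (0 : ℝ) < #S := by exact_mod_cast hS0
    have hn : (0 : ℝ) < Fintype.card V := by positivity
    rw [setVertexConductance, le_div_iff₀ hs]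
    have h5 : (#S : ℝ) / 2 ≤ centeredSq (fun x => if x ∈ S then (1 : ℝ) else 0) := by
      rw [centeredSq_indicator]
      have : (#S : ℝ) ^ 2 / Fintype.card V ≤ #S / 2 := by
        rw [div_le_iff₀ hn]; nlinarith
      linarith
    nlinarith [mul_le_mul_of_nonneg_left h5 h0]

/-- The optimal spectral gap is attained. -/
theorem isGreatest_optimalSpectralGap (hV : 2 ≤ Fintype.card V) (G : SimpleGraph V) :
    IsGreatest (spectralGap '' chains G (unif V)) (optimalSpectralGap G) := by
  have hne : Nonempty V := Fintype.card_pos_iff.1 (by omega)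
  -- Adjoining γ as a variable makes the Poincaré inequality a closed condition, so continuity of
  -- the eigenvalues is not needed. The range [0, 2] loses nothing since gaps are at most Ψ* ≤ 2.
  set T : Set (Matrix V V ℝ × ℝ) := (chains G (unif V) ×ˢ Set.Icc 0 2) ∩
    {q | ∀ f : V → ℝ, q.2 * centeredSq f ≤ energy q.1 f} with hT
  have hTc : IsCompact T := by
    refine ((isCompact_chains_unif G).prod isCompact_Icc).inter_right ?_
    rw [Set.ofPred_forall]
    refine isClosed_iInter fun f => isClosed_le (by fun_prop) ?_
    unfold energy
    fun_prop
  have hmem : ∀ P ∈ chains G (unif V), (P, spectralGap P) ∈ T := by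
    intro P hP
    refine ⟨⟨hP, ?_, ?_⟩, fun f => (le_spectralGap_iff_of_mem_chains hV hP _).1 le_rfl f⟩
    · exact (le_spectralGap_iff_of_mem_chains hV hP 0).2 fun f => by
        rw [zero_mul]; exact energy_nonneg hP.1.1 f
    · exact (spectralGap_le_vertexConductance hV hP).trans (vertexConductance_le_two hV G)
  obtain ⟨⟨P, γ⟩, hPT, hmax⟩ := hTc.exists_isMaxOn ⟨_, hmem 1 (one_mem_chains_unif G)⟩
    continuous_snd.continuousOn
  have hP : P ∈ chains G (unif V) := hPT.1.1
  have hγ : γ ≤ spectralGap P := (le_spectralGap_iff_of_mem_chains hV hP γ).2 hPT.2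
  have hg : IsGreatest (spectralGap '' chains G (unif V)) (spectralGap P) := by
    refine ⟨⟨P, hP, rfl⟩, ?_⟩
    rintro _ ⟨Q, hQ, rfl⟩
    exact (hmax (hmem Q hQ)).trans hγ
  rw [optimalSpectralGap, hg.csSup_eq]
  exact hg

end

/-! ### Cheeger inequality for scalar functions -/

section

variable {V : Type*} [Fintype V] [DecidableEq V]

/-- The vertices `z` for which `√s` is within `r z` of `f z` form a vertex cover of the cut of the
superlevel set `{f ^ 2 > s}`, so this superlevel set is not much larger. -/
lemma vertexConductance_mul_card_superlevel_le (hV : 2 ≤ Fintype.card V) (G : SimpleGraph V)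
    {f r : V → ℝ} (hf : ∀ x, 0 ≤ f x) (hr : ∀ x, 0 ≤ r x)
    (hfr : ∀ x y, G.Adj x y → f x - f y ≤ r x + r y)
    {s : ℝ} (hs : 0 ≤ s) (hsupp : 2 * #{x | s < f x ^ 2} ≤ Fintype.card V) :
    vertexConductance G * #{x | s < f x ^ 2}
      ≤ 3 * #{x | max (f x - r x) 0 ^ 2 ≤ s ∧ s ≤ (f x + r x) ^ 2} := by
  set S : Finset V := {x | s < f x ^ 2} with hS
  set W : Finset V := {x | max (f x - r x) 0 ^ 2 ≤ s ∧ s ≤ (f x + r x) ^ 2} with hW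
  have hτ := Real.sqrt_nonneg s
  have hτs := Real.sq_sqrt hs
  set τ := √s
  -- A vertex of `S \ W` has `τ < f x - r x`. A neighbour outside `S` has `f y ≤ τ`, and the
  -- increment bound then forces `τ < f y + r y`, so it lies in `W`.
  have hsub : vertexBoundary G (S \ W) ⊆ W := by
    intro y hy
    simp only [vertexBoundary, mem_filter, mem_univ, true_and, mem_sdiff] at hy
    obtain ⟨hy1, x, ⟨hxS, hxW⟩, hadj⟩ := hy
    by_contra hyW
    have hyS : y ∉ S := fun h => hy1 ⟨h, hyW⟩
    simp only [hS, mem_filter, mem_univ, true_and, not_lt] at hxS hyS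
    have h1 : τ < f x := lt_of_pow_lt_pow_left₀ 2 (hf x) (by rw [hτs]; exact hxS)
    have h2 : τ < f x - r x := by
      by_contra h
      refine hxW ?_
      simp only [hW, mem_filter, mem_univ, true_and]
      rw [← hτs]
      constructor
      · exact pow_le_pow_left₀ (le_max_right _ _) (max_le (not_lt.1 h) hτ) 2
      · exact pow_le_pow_left₀ hτ (by linarith [hr x]) 2
    have h3 := hfr x y hadj
    refine hyW ?_
    simp only [hW, mem_filter, mem_univ, true_and]
    constructor
    · exact (pow_le_pow_left₀ (le_max_right _ _) (max_le (by linarith [hr y]) (hf y)) 2).trans hyS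
    · rw [← hτs]
      exact pow_le_pow_left₀ hτ (by linarith) 2
  have h1 := vertexConductance_mul_le G (S := S \ W)
    (by have := card_le_card (sdiff_subset (s := S) (t := W)); omega)
  have h2 : (#(vertexBoundary G (S \ W)) : ℝ) ≤ #W := by exact_mod_cast card_le_card hsub
  have h3 : (#S : ℝ) ≤ #(S \ W) + #W := by
    have := card_le_card_sdiff_add_card (s := S) (t := W)
    exact_mod_cast this
  -- Ψ|S| ≤ Ψ|S \ W| + Ψ|W| ≤ |W| + 2|W|, whence the factor 3.
  have h4 := vertexConductance_le_two hV G
  have h5 := vertexConductance_nonneg G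
  have h6 : (0 : ℝ) ≤ #W := by positivity
  nlinarith [mul_le_mul_of_nonneg_left h3 h5, mul_le_mul_of_nonneg_right h4 h6]

/-- Integrating the bound on the superlevel sets over all levels. -/
lemma vertexConductance_mul_sum_sq_le (hV : 2 ≤ Fintype.card V) (G : SimpleGraph V)
    {f r : V → ℝ} (hf : ∀ x, 0 ≤ f x) (hr : ∀ x, 0 ≤ r x)
    (hfr : ∀ x y, G.Adj x y → f x - f y ≤ r x + r y)
    (hsupp : 2 * #{x | 0 < f x} ≤ Fintype.card V) :
    vertexConductance G * ∑ x, f x ^ 2 ≤ 3 * ∑ x, (4 * (f x * r x) + r x ^ 2) := by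
  -- Layer cake in the variable s = t²: vertex `x` is in the superlevel set for `s` in `A x`, of
  -- length `f x ^ 2`, and in the cover for `s` in `B x`.
  set A : V → Set ℝ := fun x => Set.Ico 0 (f x ^ 2)
  set B : V → Set ℝ := fun x => Set.Icc (max (f x - r x) 0 ^ 2) ((f x + r x) ^ 2)
  have hA : ∀ x, MeasureTheory.Integrable ((A x).indicator fun _ => (1 : ℝ)) := fun x =>
    (MeasureTheory.integrable_indicator_iff measurableSet_Ico).2 (by simp)
  have hB : ∀ x, MeasureTheory.Integrable ((B x).indicator fun _ => (1 : ℝ)) := fun x =>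
    (MeasureTheory.integrable_indicator_iff measurableSet_Icc).2 (by simp)
  have hpt : ∀ s : ℝ, vertexConductance G * ∑ x, (A x).indicator (fun _ => (1 : ℝ)) s
      ≤ 3 * ∑ x, (B x).indicator (fun _ => (1 : ℝ)) s := by
    intro s
    rcases lt_or_ge s 0 with hs | hs
    · have : ∀ x, (A x).indicator (fun _ => (1 : ℝ)) s = 0 := fun x =>
        Set.indicator_of_notMem (fun h => absurd h.1 (not_le.2 hs)) _
      simp only [this, sum_const_zero, mul_zero]
      exact mul_nonneg (by norm_num) (sum_nonneg fun x _ =>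
        Set.indicator_nonneg (fun _ _ => zero_le_one) _)
    · have h1 : #{x | s < f x ^ 2} ≤ #{x | 0 < f x} := by
        refine card_le_card fun x hx => ?_
        simp only [mem_filter, mem_univ, true_and] at hx ⊢
        rcases (hf x).lt_or_eq with h | h
        · exact h
        · rw [← h] at hx; norm_num at hx; linarith
      have := vertexConductance_mul_card_superlevel_le hV G hf hr hfr hs (by omega)
      have e1 : ∑ x, (A x).indicator (fun _ => (1 : ℝ)) s = #{x | s < f x ^ 2} := by
        simp [Set.indicator_apply, A, hs]
      have e2 : ∑ x, (B x).indicator (fun _ => (1 : ℝ)) s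
          = #{x | max (f x - r x) 0 ^ 2 ≤ s ∧ s ≤ (f x + r x) ^ 2} := by
        simp [Set.indicator_apply, B]
      rw [e1, e2]
      exact this
  have hint := MeasureTheory.integral_mono
    ((MeasureTheory.integrable_finsetSum univ fun x _ => hA x).const_mul (vertexConductance G))
    ((MeasureTheory.integrable_finsetSum univ fun x _ => hB x).const_mul 3) hpt
  simp only [MeasureTheory.integral_const_mul] at hint
  rw [MeasureTheory.integral_finsetSum _ fun x _ => hA x,
    MeasureTheory.integral_finsetSum _ fun x _ => hB x] at hint
  have hAi : ∀ x, ∫ s, (A x).indicator (fun _ => (1 : ℝ)) s = f x ^ 2 := by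
    intro x
    rw [MeasureTheory.integral_indicator_const _ measurableSet_Ico]
    simp [sq_nonneg]
  have hBi : ∀ x, ∫ s, (B x).indicator (fun _ => (1 : ℝ)) s ≤ 4 * (f x * r x) + r x ^ 2 := by
    intro x
    have hfx := hf x
    have hrx := hr x
    rw [MeasureTheory.integral_indicator_const _ measurableSet_Icc]
    have hle : max (f x - r x) 0 ^ 2 ≤ (f x + r x) ^ 2 :=
      pow_le_pow_left₀ (le_max_right _ _) (max_le (by linarith) (by linarith)) 2
    simp only [Real.volume_real_Icc_of_le hle, smul_eq_mul, mul_one]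
    -- The length is exactly 4fr if r ≤ f; otherwise it is (f + r)², and f² ≤ fr.
    rcases le_total (f x - r x) 0 with h | h
    · rw [max_eq_right h]; nlinarith
    · rw [max_eq_left h]; nlinarith
  simp only [hAi] at hint
  exact hint.trans (mul_le_mul_of_nonneg_left (sum_le_sum fun x _ => hBi x) (by norm_num))

/-- A Cheeger inequality for vertex conductance, for functions that vanish on at least half of the
vertices. -/
lemma sq_vertexConductance_mul_sum_sq_le (hV : 2 ≤ Fintype.card V) (G : SimpleGraph V)
    {f g : V → ℝ} (hf : ∀ x, 0 ≤ f x) (hg : ∀ x, 0 ≤ g x)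
    (hfg : ∀ x y, G.Adj x y → (f x - f y) ^ 2 ≤ g x + g y)
    (hsupp : 2 * #{x | 0 < f x} ≤ Fintype.card V) :
    vertexConductance G ^ 2 * ∑ x, f x ^ 2 ≤ 156 * ∑ x, g x := by
  have hfr : ∀ x y, G.Adj x y → f x - f y ≤ √(g x) + √(g y) := by
    intro x y hxy
    refine le_of_sq_le_sq ?_ (by positivity)
    have := hfg x y hxy
    have h1 := Real.sq_sqrt (hg x)
    have h2 := Real.sq_sqrt (hg y)
    have h3 := mul_nonneg (Real.sqrt_nonneg (g x)) (Real.sqrt_nonneg (g y))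
    nlinarith
  have h := vertexConductance_mul_sum_sq_le hV G hf (fun x => Real.sqrt_nonneg (g x)) hfr hsupp
  set Ψ := vertexConductance G
  have hΨ0 : 0 ≤ Ψ := vertexConductance_nonneg G
  have hΨ2 : Ψ ≤ 2 := vertexConductance_le_two hV G
  -- Here 12Ψf√g ≤ Ψ²f²/2 + 72g and 3Ψg ≤ 6g. The term Ψ²f²/2 is absorbed on the left, turning 78
  -- into 156.
  have hpt : ∀ x, Ψ * (3 * (4 * (f x * √(g x)) + √(g x) ^ 2))
      ≤ Ψ ^ 2 / 2 * f x ^ 2 + 78 * g x := by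
    intro x
    have h1 := Real.sq_sqrt (hg x)
    have h2 : Ψ * g x ≤ 2 * g x := mul_le_mul_of_nonneg_right hΨ2 (hg x)
    rw [h1]
    nlinarith [sq_nonneg (Ψ * f x - 12 * √(g x))]
  have h2 : Ψ * (3 * ∑ x, (4 * (f x * √(g x)) + √(g x) ^ 2))
      ≤ Ψ ^ 2 / 2 * ∑ x, f x ^ 2 + 78 * ∑ x, g x := by
    simp only [mul_sum, ← sum_add_distrib] at hpt ⊢
    exact sum_le_sum fun x _ => hpt x
  nlinarith [mul_le_mul_of_nonneg_left h hΨ0]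

/-- Take the least value of `f` that is exceeded on at most half of the vertices; the next smaller
value is exceeded on more than half. -/
lemma exists_median (f : V → ℝ) (hV : 0 < Fintype.card V) :
    ∃ m : ℝ, 2 * #{x | m < f x} ≤ Fintype.card V ∧ 2 * #{x | f x < m} ≤ Fintype.card V := by
  have : Nonempty V := Fintype.card_pos_iff.1 hV
  set T : Finset V := {z | 2 * #{x | f z < f x} ≤ Fintype.card V}
  have hT : T.Nonempty := by
    obtain ⟨z, -, hz⟩ := exists_max_image univ f univ_nonempty
    refine ⟨z, ?_⟩
    have : #{x | f z < f x} = 0 := by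
      rw [card_eq_zero, filter_eq_empty_iff]
      exact fun x hx => not_lt.2 (hz x hx)
    simp [T, this]
  obtain ⟨z, hzT, hz⟩ := exists_min_image T f hT
  refine ⟨f z, by simpa [T] using hzT, ?_⟩
  rcases (filter (fun x => f x < f z) univ).eq_empty_or_nonempty with h | h
  · simp [h]
  · obtain ⟨w, hw, hwmax⟩ := exists_max_image _ f h
    have hw' : f w < f z := by simpa using hw
    have h1 : ¬ 2 * #{x | f w < f x} ≤ Fintype.card V := fun h' =>
      absurd (hz w (by simpa [T] using h')) (not_le.2 hw')
    have h2 : #{x | f x < f z} + #{x | f w < f x} ≤ Fintype.card V := by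
      rw [← card_union_of_disjoint]
      · exact card_le_univ _
      · rw [disjoint_left]
        intro x hx hx'
        have := hwmax x hx
        simp only [mem_filter, mem_univ, true_and] at hx'
        linarith
    omega

/-- A Cheeger inequality for vertex conductance. -/
theorem sq_vertexConductance_mul_centeredSq_le (hV : 2 ≤ Fintype.card V) (G : SimpleGraph V)
    {f g : V → ℝ} (hg : ∀ x, 0 ≤ g x) (hfg : ∀ x y, G.Adj x y → (f x - f y) ^ 2 ≤ g x + g y) :
    vertexConductance G ^ 2 * centeredSq f ≤ 312 * ∑ x, g x := by
  have hne : Nonempty V := Fintype.card_pos_iff.1 (by omega)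
  obtain ⟨m, hm1, hm2⟩ := exists_median f (by omega)
  have hmax : ∀ a b : ℝ, (max a 0 - max b 0) ^ 2 ≤ (a - b) ^ 2 := fun a b =>
    sq_le_sq.2 (abs_max_sub_max_le_abs a b 0)
  -- Positive and negative parts about the median each vanish on at least half of the vertices. Each
  -- pays 156 times the sum of `g`.
  have h1 := sq_vertexConductance_mul_sum_sq_le hV G (f := fun x => max (f x - m) 0)
    (fun x => le_max_right _ _) hg
    (fun x y hxy => (hmax _ _).trans (by have := hfg x y hxy; ring_nf at this ⊢; exact this))
    (by simpa using hm1)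
  have h2 := sq_vertexConductance_mul_sum_sq_le hV G (f := fun x => max (m - f x) 0)
    (fun x => le_max_right _ _) hg
    (fun x y hxy => (hmax _ _).trans (by have := hfg x y hxy; ring_nf at this ⊢; exact this))
    (by simpa using hm2)
  have h3 : ∑ x, (f x - m) ^ 2 = ∑ x, max (f x - m) 0 ^ 2 + ∑ x, max (m - f x) 0 ^ 2 := by
    rw [← sum_add_distrib]
    refine sum_congr rfl fun x _ => ?_
    rcases le_total (f x) m with h | h
    · rw [max_eq_right (by linarith), max_eq_left (by linarith)]; ring
    · rw [max_eq_left (by linarith), max_eq_right (by linarith)]; ring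
  have h4 := centeredSq_le f m
  nlinarith [mul_le_mul_of_nonneg_left h4 (sq_nonneg (vertexConductance G))]

end

/-! ### Maximal matchings and their lazy walks -/

section

variable {V : Type*} [Fintype V] [DecidableEq V]

/-- A matching of maximal weight, as an involution. -/
lemma exists_dominating_matching (G : SimpleGraph V) {w : V → V → ℝ} (hsymm : ∀ x y, w x y = w y x)
    (hnn : ∀ x y, 0 ≤ w x y) (hdiag : ∀ x, w x x = 0) :
    ∃ σ : V → V, (∀ x, σ (σ x) = x) ∧ (∀ x, σ x ≠ x → G.Adj x (σ x)) ∧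
      ∀ x y, G.Adj x y → w x y ≤ w x (σ x) + w y (σ y) := by
  obtain ⟨σ, ⟨hσ, hσG⟩, hmax⟩ := Set.exists_max_image
    {σ : V → V | (∀ x, σ (σ x) = x) ∧ ∀ x, σ x ≠ x → G.Adj x (σ x)}
    (fun σ => ∑ x, w x (σ x)) (Set.toFinite _) ⟨id, by simp⟩
  refine ⟨σ, hσ, hσG, fun x y hxy => ?_⟩
  by_cases hxσ : σ x = y
  · rw [hxσ]; linarith [hnn y (σ y)]
  have hyσ : σ y ≠ x := fun h => hxσ (by rw [← h, hσ])
  have hne : x ≠ y := hxy.ne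
  -- The exchange: match `x` with `y`, leave their former partners single, keep the rest. Each pair
  -- is counted twice in the weight.
  set τ : V → V := fun z => if z = x then y else if z = y then x else
    if z = σ x ∨ z = σ y then z else σ z with hτ
  have hτmem : (∀ z, τ (τ z) = z) ∧ ∀ z, τ z ≠ z → G.Adj z (τ z) := by
    constructor
    · intro z
      by_cases h1 : z = x
      · simp [hτ, h1, hne.symm]
      by_cases h2 : z = y
      · simp [hτ, h2, hne.symm]
      by_cases h3 : z = σ x ∨ z = σ y
      · have : τ z = z := by simp only [hτ, if_neg h1, if_neg h2, if_pos h3]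
        rw [this, this]
      · have e : τ z = σ z := by simp only [hτ, if_neg h1, if_neg h2, if_neg h3]
        push Not at h3
        have h4 : σ z ≠ x := fun h => h3.1 (by rw [← h, hσ])
        have h5 : σ z ≠ y := fun h => h3.2 (by rw [← h, hσ])
        have h6 : ¬ (σ z = σ x ∨ σ z = σ y) := by
          rintro (h | h)
          · exact h1 (by rw [← hσ z, h, hσ])
          · exact h2 (by rw [← hσ z, h, hσ])
        rw [e]
        simp only [hτ, if_neg h4, if_neg h5, if_neg h6, hσ]
    · intro z
      simp only [hτ]
      split_ifs with h1 h2 h3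
      · subst h1; exact fun _ => hxy
      · subst h2; exact fun _ => hxy.symm
      · exact fun h => absurd rfl h
      · exact hσG z
  have h := hmax τ hτmem
  have hpt : ∀ z, w z (σ z) - w z (τ z) ≤ (if z = x then w x (σ x) - w x y else 0)
      + (if z = y then w y (σ y) - w x y else 0) + (if z = σ x then w x (σ x) else 0)
      + (if z = σ y then w y (σ y) else 0) := by
    intro z
    have hx0 := hnn x (σ x)
    have hy0 := hnn y (σ y)
    have n3 : 0 ≤ if z = σ x then w x (σ x) else 0 := by split_ifs <;> linarith
    have n4 : 0 ≤ if z = σ y then w y (σ y) else 0 := by split_ifs <;> linarith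
    by_cases h1 : z = x
    · subst h1
      have : τ z = y := by simp [hτ]
      rw [this, if_pos rfl, if_neg hne]
      linarith
    by_cases h2 : z = y
    · subst h2
      have : τ z = x := by simp [hτ, h1]
      rw [this, if_neg h1, if_pos rfl, hsymm x z]
      linarith
    rw [if_neg h1, if_neg h2]
    by_cases h3 : z = σ x ∨ z = σ y
    · have e : τ z = z := by simp only [hτ, if_neg h1, if_neg h2, if_pos h3]
      rw [e, hdiag]
      rcases h3 with h3 | h3
      · rw [if_pos h3, h3, hσ, hsymm (σ x) x]
        rw [h3] at n4
        linarith
      · rw [if_pos h3]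
        have : w z (σ z) = w y (σ y) := by rw [h3, hσ, hsymm]
        linarith
    · have e : τ z = σ z := by simp only [hτ, if_neg h1, if_neg h2, if_neg h3]
      rw [e]
      linarith
  have h' := sum_le_sum fun z (_ : z ∈ univ) => hpt z
  simp only [sum_sub_distrib, sum_add_distrib, sum_ite_eq', mem_univ, if_true] at h'
  linarith

/-- The lazy walk along a matching. -/
def matchingChain (σ : V → V) : Matrix V V ℝ := fun x y =>
  (if x = y then 1 / 2 else 0) + (if σ x = y then 1 / 2 else 0)

lemma matchingChain_mem_chains [Nonempty V] {G : SimpleGraph V} {σ : V → V}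
    (hσ : ∀ x, σ (σ x) = x) (hG : ∀ x, σ x ≠ x → G.Adj x (σ x)) :
    matchingChain σ ∈ chains G (unif V) := by
  rw [mem_chains_unif_iff]
  unfold matchingChain
  refine ⟨fun x y => by positivity, fun x => ?_, fun x y h hadj => ?_, fun x => ?_, fun x y => ?_⟩
  · simp [sum_add_distrib]; norm_num
  · have : σ x ≠ y := by
      rintro rfl; exact hadj (hG x (Ne.symm h))
    simp [h, this]
  · rw [if_pos rfl]
    have : (0 : ℝ) ≤ if σ x = x then 1 / 2 else 0 := by positivity
    linarith
  · have : σ x = y ↔ σ y = x := ⟨fun h => by rw [← h, hσ], fun h => by rw [← h, hσ]⟩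
    simp only [eq_comm (a := x) (b := y), this]

lemma energy_matchingChain (σ : V → V) (f : V → ℝ) :
    energy (matchingChain σ) f = 1 / 4 * ∑ x, (f x - f (σ x)) ^ 2 := by
  have : ∀ x, ∑ y, matchingChain σ x y * (f x - f y) ^ 2 = 1 / 2 * (f x - f (σ x)) ^ 2 := by
    intro x
    simp [matchingChain, add_mul, sum_add_distrib]
  simp only [energy, this, ← mul_sum]
  ring

end

/-! ### Random signs and the vector-valued Cheeger inequality -/

section

/-- The sign `±1` encoded by a boolean. -/
def sgn (b : Bool) : ℝ := if b then 1 else -1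

section signs

variable {ι : Type*} [Fintype ι] [DecidableEq ι]

lemma sum_signs_prod (h : ι → Bool → ℝ) :
    ∑ s : ι → Bool, ∏ i, h i (s i) = ∏ i, (h i true + h i false) := by
  have := prod_univ_sum (fun _ : ι => (univ : Finset Bool)) h
  rw [Fintype.piFinset_univ] at this
  rw [← this]
  simp

/-- Hoeffding's bound: by independence the exponential moment factors into cosh terms, each at most
exp(c²/2). -/
lemma sum_signs_cosh_le (c : ι → ℝ) :
    ∑ s : ι → Bool, Real.cosh (∑ i, sgn (s i) * c i)
      ≤ 2 ^ Fintype.card ι * Real.exp ((∑ i, c i ^ 2) / 2) := by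
  have hexp : ∀ c : ι → ℝ, ∑ s : ι → Bool, Real.exp (∑ i, sgn (s i) * c i)
      = ∏ i, (2 * Real.cosh (c i)) := by
    intro c
    simp only [Real.exp_sum]
    rw [sum_signs_prod fun i b => Real.exp (sgn b * c i)]
    refine prod_congr rfl fun i _ => ?_
    simp [sgn, Real.cosh_eq]; ring
  have h1 : ∑ s : ι → Bool, Real.cosh (∑ i, sgn (s i) * c i) = ∏ i, (2 * Real.cosh (c i)) := by
    have h2 := hexp c
    have h3 := hexp fun i => -c i
    simp only [mul_neg, sum_neg_distrib, Real.cosh_neg] at h3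
    simp only [Real.cosh_eq (∑ i, _), ← sum_div, sum_add_distrib, h2, h3]
    ring
  rw [h1, sum_div, Real.exp_sum, ← card_univ, ← prod_const, ← prod_mul_distrib]
  refine prod_le_prod (fun i _ => ?_) fun i _ => ?_
  · have := Real.cosh_pos (c i); positivity
  · exact mul_le_mul_of_nonneg_left (Real.cosh_le_exp_half_sq _) (by norm_num)

lemma sum_signs_sq (c : ι → ℝ) :
    ∑ s : ι → Bool, (∑ i, sgn (s i) * c i) ^ 2 = 2 ^ Fintype.card ι * ∑ i, c i ^ 2 := by
  have hsq : ∀ b, sgn b * sgn b = 1 := by rintro (_ | _) <;> simp [sgn]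
  have hij : ∀ i j, i ≠ j → ∑ s : ι → Bool, sgn (s i) * sgn (s j) = 0 := by
    intro i j hij
    have h1 : ∀ s : ι → Bool, sgn (s i) * sgn (s j)
        = ∏ k, (if k = i ∨ k = j then sgn (s k) else 1) := by
      intro s
      have : (univ.filter fun k => k = i ∨ k = j) = {i, j} := by ext k; simp
      rw [← prod_filter, this, prod_pair hij]
    simp only [h1]
    rw [sum_signs_prod fun k b => if k = i ∨ k = j then sgn b else 1]
    exact prod_eq_zero (mem_univ i) (by simp [sgn])
  have h : ∀ i j, ∑ s : ι → Bool, sgn (s i) * sgn (s j)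
      = if i = j then 2 ^ Fintype.card ι else 0 := by
    intro i j
    split_ifs with e
    · subst e; simp [hsq]
    · exact hij i j e
  simp only [sq, sum_mul_sum]
  rw [sum_comm]
  have : ∀ i, ∑ s : ι → Bool, ∑ j, sgn (s i) * c i * (sgn (s j) * c j)
      = 2 ^ Fintype.card ι * (c i * c i) := by
    intro i
    rw [sum_comm]
    have : ∀ j, ∑ s : ι → Bool, sgn (s i) * c i * (sgn (s j) * c j)
        = (if i = j then 2 ^ Fintype.card ι else 0) * (c i * c j) := by
      intro j
      rw [← h, sum_mul]
      exact sum_congr rfl fun s _ => by ring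
    simp [this]
  simp only [this, mul_sum]

end signs

/-- For t ≥ L, t² ≤ 2L² + 2(t - L)² and (t - L)² ≤ 2exp(t - L). Summing the cosh term over
neighbours bounds the largest squared increment, with truncation level `L`. -/
lemma sq_le_two_mul_sq_add_cosh {L : ℝ} (hL : 0 ≤ L) (t : ℝ) :
    t ^ 2 ≤ 2 * L ^ 2 + 8 * Real.exp (-L) * Real.cosh t := by
  wlog ht : 0 ≤ t generalizing t
  · have := this (-t) (by linarith)
    simpa using this
  have hc : Real.exp t ≤ 2 * Real.cosh t := by
    rw [Real.cosh_eq]; linarith [Real.exp_pos (-t)]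
  have he := Real.exp_pos (-L)
  rcases le_total t L with h | h
  · have := Real.cosh_pos t
    have : 0 ≤ 8 * Real.exp (-L) * Real.cosh t := by positivity
    nlinarith
  · have h1 : (t - L) ^ 2 / 2 ≤ Real.exp (t - L) := by
      have := Real.quadratic_le_exp_of_nonneg (sub_nonneg.2 h)
      linarith
    have h2 : Real.exp (t - L) = Real.exp (-L) * Real.exp t := by
      rw [← Real.exp_add]; ring_nf
    have h3 := mul_le_mul_of_nonneg_left hc he.le
    nlinarith [sq_nonneg (t - 2 * L)]

variable {V : Type*} [Fintype V] [DecidableEq V] {ι : Type*} [Fintype ι] [DecidableEq ι]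

/-- The random scalar function obtained from the coordinates `b i` of a vector-valued function. -/
def signedSum (b : ι → V → ℝ) (s : ι → Bool) (x : V) : ℝ := ∑ i, sgn (s i) * b i x

omit [DecidableEq V] in
lemma sum_centeredSq_signedSum (b : ι → V → ℝ) :
    ∑ s, centeredSq (signedSum b s) = 2 ^ Fintype.card ι * ∑ i, centeredSq (b i) := by
  have hm : ∀ s, mean (signedSum b s) = ∑ i, sgn (s i) * mean (b i) := by
    intro s
    simp only [mean, signedSum]
    rw [sum_comm, sum_div]
    simp only [← mul_sum, mul_div_assoc]
  have : ∀ s x, signedSum b s x - mean (signedSum b s)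
      = ∑ i, sgn (s i) * (b i x - mean (b i)) := by
    intro s x
    rw [hm, signedSum, ← sum_sub_distrib]
    exact sum_congr rfl fun i _ => by ring
  simp only [centeredSq, this]
  rw [sum_comm]
  simp only [sum_signs_sq fun i => b i _ - mean (b i)]
  rw [← mul_sum, sum_comm]

/-- A Cheeger inequality for vertex conductance and vector-valued functions, with a logarithmic
loss coming from a random projection to the line. -/
theorem sq_vertexConductance_mul_sum_centeredSq_le (hV : 2 ≤ Fintype.card V) (G : SimpleGraph V)
    {b : ι → V → ℝ} {g : V → ℝ} (hg : ∀ x, 0 ≤ g x)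
    (hbg : ∀ x y, G.Adj x y → ∑ i, (b i x - b i y) ^ 2 ≤ g x + g y) :
    vertexConductance G ^ 2 * ∑ i, centeredSq (b i)
      ≤ 6864 * Real.log (Fintype.card V) * ∑ x, g x := by
  classical
  set l := Real.log (Fintype.card V) with hl
  have hn : (2 : ℝ) ≤ Fintype.card V := by exact_mod_cast hV
  have hl2 : 0.69 ≤ l := by
    have := Real.log_le_log (by norm_num) hn
    linarith [Real.log_two_gt_d9]
  have hl0 : 0 < l := by linarith
  have hel : Real.exp l = Fintype.card V := Real.exp_log (by linarith)
  -- Chosen so that exp(-L) · |V| · exp(l/2) = 1: a union bound over at most |V| neighbours, each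
  -- with mean cosh at most exp(l/2).
  set L := 3 / 2 * l with hL
  set D : (ι → Bool) → V → V → ℝ := fun s x y =>
    ∑ i, sgn (s i) * (√l * ((b i x - b i y) / √(g x + g y))) with hD
  have hDeq : ∀ s x y, D s x y = √l * ((signedSum b s x - signedSum b s y) / √(g x + g y)) := by
    intro s x y
    simp only [hD, signedSum, ← sum_sub_distrib, sum_div, mul_sum]
    exact sum_congr rfl fun i _ => by ring
  have hDsymm : ∀ s x y, Real.cosh (D s x y) = Real.cosh (D s y x) := by
    intro s x y
    rw [← Real.cosh_neg, hDeq, hDeq, add_comm (g x)]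
    congr 1; ring
  set H : (ι → Bool) → V → ℝ := fun s x =>
    2 * L ^ 2 + 8 * Real.exp (-L) * ∑ y ∈ univ.filter (G.Adj x), Real.cosh (D s x y) with hH
  have hH1 : ∀ s x y, G.Adj x y → D s x y ^ 2 ≤ H s x := by
    intro s x y hxy
    refine (sq_le_two_mul_sq_add_cosh (L := L) (by positivity) _).trans ?_
    have := single_le_sum (f := fun y => Real.cosh (D s x y)) (fun z _ => (Real.cosh_pos _).le)
      (mem_filter.2 ⟨mem_univ y, hxy⟩)
    have := mul_le_mul_of_nonneg_left this (by positivity : 0 ≤ 8 * Real.exp (-L))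
    simp only [hH]; linarith
  have hH0 : ∀ s x, 0 ≤ H s x := by
    intro s x
    have : 0 ≤ ∑ y ∈ univ.filter (G.Adj x), Real.cosh (D s x y) :=
      sum_nonneg fun y _ => (Real.cosh_pos _).le
    positivity
  have hDsq : ∀ s x y, D s x y ^ 2 = D s y x ^ 2 := by
    intro s x y
    rw [hDeq, hDeq, add_comm (g x)]; ring
  have hline : ∀ s, vertexConductance G ^ 2 * centeredSq (signedSum b s)
      ≤ 312 * ∑ x, g x * H s x / l := by
    intro s
    refine sq_vertexConductance_mul_centeredSq_le hV G
      (fun x => div_nonneg (mul_nonneg (hg x) (hH0 s x)) hl0.le) fun x y hxy => ?_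
    have hb := hbg x y hxy
    have hkey : (signedSum b s x - signedSum b s y) ^ 2 = D s x y ^ 2 * (g x + g y) / l := by
      -- When `g x + g y = 0` the normalised increment is 0 by the convention for division, and the
      -- true increment vanishes too.
      rcases (add_nonneg (hg x) (hg y)).eq_or_lt with h0 | hpos
      · have hz : ∀ i, b i x - b i y = 0 := by
          have h1 : ∑ i, (b i x - b i y) ^ 2 = 0 :=
            le_antisymm (by rw [h0]; exact hb) (sum_nonneg fun i _ => sq_nonneg _)
          intro i
          have := (sum_eq_zero_iff_of_nonneg fun i _ => sq_nonneg (b i x - b i y)).1 h1 i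
            (mem_univ i)
          exact pow_eq_zero_iff (two_ne_zero) |>.1 this
        have : signedSum b s x - signedSum b s y = 0 := by
          simp only [signedSum, ← sum_sub_distrib, ← mul_sub, hz, mul_zero, sum_const_zero]
        rw [this, ← h0]; simp
      · rw [hDeq, mul_pow, div_pow, Real.sq_sqrt hl0.le, Real.sq_sqrt hpos.le]
        field_simp
    rw [hkey, ← add_div]
    refine div_le_div_of_nonneg_right ?_ hl0.le
    have h1 := mul_le_mul_of_nonneg_right (hH1 s x y hxy) (hg x)
    have h2 := mul_le_mul_of_nonneg_right (hH1 s y x hxy.symm) (hg y)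
    rw [← hDsq] at h2
    linarith
  have hHsum : ∀ x, ∑ s, H s x ≤ 2 ^ Fintype.card ι * (22 * l ^ 2) := by
    intro x
    have h1 : ∀ y ∈ univ.filter (G.Adj x), ∑ s, Real.cosh (D s x y)
        ≤ 2 ^ Fintype.card ι * Real.exp (l / 2) := by
      intro y hy
      refine (sum_signs_cosh_le _).trans ?_
      refine mul_le_mul_of_nonneg_left (Real.exp_le_exp.2 ?_) (by positivity)
      refine div_le_div_of_nonneg_right ?_ (by norm_num)
      simp only [mul_pow, div_pow, Real.sq_sqrt hl0.le, Real.sq_sqrt (add_nonneg (hg x) (hg y)),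
        ← mul_sum, ← sum_div]
      have := div_le_one_of_le₀ (hbg x y (mem_filter.1 hy).2) (add_nonneg (hg x) (hg y))
      nlinarith
    have h2 : ∑ s, ∑ y ∈ univ.filter (G.Adj x), Real.cosh (D s x y)
        ≤ Fintype.card V * (2 ^ Fintype.card ι * Real.exp (l / 2)) := by
      rw [sum_comm]
      refine (sum_le_sum h1).trans ?_
      rw [sum_const, nsmul_eq_mul]
      refine mul_le_mul_of_nonneg_right ?_ (by positivity)
      exact_mod_cast card_le_univ _
    have h3 : Real.exp (-L) * (Fintype.card V * (2 ^ Fintype.card ι * Real.exp (l / 2)))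
        = 2 ^ Fintype.card ι := by
      have : Real.exp (-L) * Real.exp l * Real.exp (l / 2) = 1 := by
        rw [← Real.exp_add, ← Real.exp_add, hL, Real.exp_eq_one_iff]; ring
      rw [← hel]
      linear_combination (2 : ℝ) ^ Fintype.card ι * this
    have h4 : ∑ s, H s x = 2 ^ Fintype.card ι * (2 * L ^ 2)
        + 8 * (Real.exp (-L) * ∑ s, ∑ y ∈ univ.filter (G.Adj x), Real.cosh (D s x y)) := by
      simp only [hH, sum_add_distrib, ← mul_sum]
      simp; ring
    have h5 := mul_le_mul_of_nonneg_left h2 (Real.exp_pos (-L)).le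
    rw [h3] at h5
    rw [h4, hL]
    have h6 : (0 : ℝ) < 2 ^ Fintype.card ι := by positivity
    -- The average of `H` is at most 2L² + 8 = 4.5l² + 8, and l ≥ 0.69, giving 22l².
    have h7 : 8 ≤ 17.5 * l ^ 2 := by nlinarith
    nlinarith
  have hsum := sum_le_sum fun s (_ : s ∈ univ) => hline s
  rw [← mul_sum, sum_centeredSq_signedSum, ← mul_sum, sum_comm] at hsum
  have h8 : ∀ x, ∑ s, g x * H s x / l ≤ 2 ^ Fintype.card ι * (22 * l * g x) := by
    intro x
    rw [← sum_div, ← mul_sum, div_le_iff₀ hl0]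
    have := mul_le_mul_of_nonneg_left (hHsum x) (hg x)
    linarith
  have h9 := sum_le_sum fun x (_ : x ∈ univ) => h8 x
  rw [← mul_sum, ← mul_sum] at h9
  have h10 : (0 : ℝ) < 2 ^ Fintype.card ι := by positivity
  have h11 : 2 ^ Fintype.card ι * (vertexConductance G ^ 2 * ∑ i, centeredSq (b i))
      ≤ 2 ^ Fintype.card ι * (6864 * l * ∑ x, g x) := by linarith
  exact le_of_mul_le_mul_left h11 h10

end

/-! ### Minimax duality and conclusion -/

section

variable {V : Type*} [Fintype V] [DecidableEq V]

/-- The quadratic form on functions on `V` with coefficients `A`. -/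
def quadForm (A : V → V → ℝ) (f : V → ℝ) : ℝ := ∑ x, ∑ y, A x y * (f x * f y)

omit [DecidableEq V] in
lemma quadForm_mul_self (h f : V → ℝ) :
    quadForm (fun x y => h x * h y) f = (∑ x, h x * f x) ^ 2 := by
  rw [quadForm, sq, sum_mul_sum]
  exact sum_congr rfl fun x _ => sum_congr rfl fun y _ => by ring

/-- Separation from the cone of positive semidefinite forms: a convex compact set of coefficient
matrices on none of whose members the form is positive semidefinite is negative on some sum of
squares. -/
lemma exists_sum_quadForm_neg {K : Set (V → V → ℝ)} (hconv : Convex ℝ K) (hcomp : IsCompact K)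
    (hK : ∀ A ∈ K, ∃ f, quadForm A f < 0) :
    ∃ (m : ℕ) (v : Fin m → V → ℝ), ∀ A ∈ K, ∑ i, quadForm A (v i) < 0 := by
  set C : Set (V → V → ℝ) := {A | ∀ f, 0 ≤ quadForm A f} with hC
  have hCconv : Convex ℝ C := by
    intro A hA B hB a b ha hb _ f
    have : quadForm (a • A + b • B) f = a * quadForm A f + b * quadForm B f := by
      simp only [quadForm, mul_sum, ← sum_add_distrib, Pi.add_apply, Pi.smul_apply, smul_eq_mul]
      exact sum_congr rfl fun x _ => sum_congr rfl fun y _ => by ring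
    rw [this]
    exact add_nonneg (mul_nonneg ha (hA f)) (mul_nonneg hb (hB f))
  have hCclosed : IsClosed C := by
    rw [hC, Set.ofPred_forall]
    refine isClosed_iInter fun f => isClosed_le continuous_const ?_
    unfold quadForm
    fun_prop
  have hdisj : Disjoint K C := by
    rw [Set.disjoint_left]
    intro A hA hAC
    obtain ⟨f, hf⟩ := hK A hA
    exact absurd (hAC f) (not_le.2 hf)
  obtain ⟨φ, u, v, hu, huv, hv⟩ :=
    geometric_hahn_banach_compact_closed hconv hcomp hCconv hCclosed hdisj
  have hv0 : v < 0 := by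
    have := hv 0 (fun f => by simp [quadForm])
    simpa using this
  -- On a cone, a functional that is bounded below is nonnegative.
  have hφ : ∀ A ∈ C, 0 ≤ φ A := by
    intro A hA
    by_contra! hneg
    have ht : 0 < v / φ A := div_pos_of_neg_of_neg hv0 hneg
    have := hv ((v / φ A) • A) (fun f => by
      have e : quadForm ((v / φ A) • A) f = v / φ A * quadForm A f := by
        simp only [quadForm, mul_sum, Pi.smul_apply, smul_eq_mul, mul_assoc]
      rw [e]
      exact mul_nonneg ht.le (hA f))
    rw [map_smul, smul_eq_mul, div_mul_cancel₀ _ hneg.ne] at this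
    exact lt_irrefl _ this
  set E : V → V → V → V → ℝ := fun x y => Pi.single x (Pi.single y 1) with hE
  set X : Matrix V V ℝ := fun x y => φ (E x y) with hX
  have hφX : ∀ A, φ A = ∑ x, ∑ y, A x y * X x y := by
    intro A
    have : A = ∑ x, ∑ y, A x y • E x y := by
      ext a b
      simp [hE, Finset.sum_apply, Pi.single_apply, ite_apply]
    conv_lhs => rw [this]
    simp only [map_sum, map_smul, smul_eq_mul, hX]
  have hEq : ∀ x y f, quadForm (E x y) f = f x * f y := by
    intro x y f
    simp [hE, quadForm, Pi.single_apply, ite_apply]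
  -- Antisymmetric coefficients give the zero form and so lie in `C` with both signs; hence `X` is
  -- symmetric. Rank-one forms in `C` make it positive semidefinite.
  have hle : ∀ x y, X y x ≤ X x y := by
    intro x y
    have := hφ (E x y - E y x) (fun f => by
      have e : quadForm (E x y - E y x) f = quadForm (E x y) f - quadForm (E y x) f := by
        simp only [quadForm, Pi.sub_apply, sub_mul, sum_sub_distrib]
      rw [e, hEq, hEq]; linarith)
    rw [map_sub] at this
    exact sub_nonneg.1 this
  have hpsd : X.PosSemidef := by
    refine PosSemidef.of_dotProduct_mulVec_nonneg ?_ fun h => ?_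
    · ext x y
      simpa using le_antisymm (hle x y) (hle y x)
    · have := hφ (fun x y => h x * h y) (fun f => by rw [quadForm_mul_self]; positivity)
      rw [hφX] at this
      refine this.trans_eq ?_
      simp only [star_trivial, dotProduct, mulVec, mul_sum]
      exact sum_congr rfl fun x _ => sum_congr rfl fun y _ => by ring
  obtain ⟨m, b, hb⟩ := posSemidef_iff_eq_sum_vecMulVec.1 hpsd
  refine ⟨m, b, fun A hA => ?_⟩
  have hlt := hu A hA
  have : φ A = ∑ i, quadForm A (b i) := by
    simp only [hφX, quadForm]
    rw [sum_comm]
    simp only [sum_comm (s := (univ : Finset (Fin m)))]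
    rw [sum_comm]
    refine sum_congr rfl fun x _ => sum_congr rfl fun y _ => ?_
    rw [hb, Matrix.sum_apply, mul_sum]
    simp [vecMulVec_apply]
  linarith

omit [DecidableEq V] in
lemma centeredSq_eq [Nonempty V] (f : V → ℝ) :
    centeredSq f = ∑ x, f x ^ 2 - (∑ x, f x) ^ 2 / Fintype.card V := by
  have h := sum_sub_sq_eq f 0
  have hc : (Fintype.card V : ℝ) ≠ 0 := by simp
  simp only [sub_zero, mean] at h
  rw [h]
  field_simp
  ring

/-- Minimax duality for the optimal spectral gap: it suffices to find, for every vector-valued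
test function, a chain that satisfies the Poincaré inequality for this test function. -/
lemma exists_chain_of_forall_test [Nonempty V] {G : SimpleGraph V} {γ : ℝ}
    (h : ∀ (m : ℕ) (b : Fin m → V → ℝ), ∃ P ∈ chains G (unif V),
      γ * ∑ i, centeredSq (b i) ≤ ∑ i, energy P (b i)) :
    ∃ P ∈ chains G (unif V), ∀ f, γ * centeredSq f ≤ energy P f := by
  by_contra! hcon
  -- Affine in `P`, so the image of the chains stays convex and compact.
  set Φ : Matrix V V ℝ → V → V → ℝ := fun P x y =>
    ((if x = y then 1 else 0) - γ * ((if x = y then 1 else 0) - 1 / (Fintype.card V : ℝ))) - P x y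
    with hΦ
  have hquad : ∀ P ∈ chains G (unif V), ∀ f,
      quadForm (Φ P) f = energy P f - γ * centeredSq f := by
    intro P hP f
    rw [energy_eq hP.1.1 (isSymm_of_isReversible_unif hP.2.2), centeredSq_eq, sq (∑ x, f x),
      sum_mul_sum]
    simp only [quadForm, hΦ, sub_mul, sum_sub_distrib, dotProduct, mulVec, mul_sub, mul_assoc,
      ← mul_sum, ite_mul, one_mul, zero_mul, sum_ite_eq, mem_univ, if_true, sq]
    have : ∑ x, ∑ y, P x y * (f x * f y) = ∑ x, f x * ∑ y, P x y * f y := by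
      simp only [mul_sum]
      exact sum_congr rfl fun x _ => sum_congr rfl fun y _ => by ring
    rw [this]
    ring
  have hconv : Convex ℝ (Φ '' chains G (unif V)) := by
    rintro _ ⟨P, hP, rfl⟩ _ ⟨Q, hQ, rfl⟩ a b ha hb hab
    refine ⟨a • P + b • Q, convex_chains_unif G hP hQ ha hb hab, ?_⟩
    ext x y
    simp only [hΦ, Matrix.add_apply, Matrix.smul_apply, Pi.add_apply, Pi.smul_apply, smul_eq_mul]
    linear_combination
      -((if x = y then 1 else 0) - γ * ((if x = y then 1 else 0) - 1 / (Fintype.card V : ℝ))) * hab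
  have hcomp : IsCompact (Φ '' chains G (unif V)) := by
    refine (isCompact_chains_unif G).image ?_
    refine continuous_pi fun x => continuous_pi fun y => continuous_const.sub ?_
    fun_prop
  obtain ⟨m, b, hb⟩ := exists_sum_quadForm_neg hconv hcomp (by
    rintro _ ⟨P, hP, rfl⟩
    obtain ⟨f, hf⟩ := hcon P hP
    exact ⟨f, by rw [hquad P hP]; linarith⟩)
  obtain ⟨P, hP, hPb⟩ := h m b
  have := hb _ ⟨P, hP, rfl⟩
  simp only [hquad P hP, sum_sub_distrib, ← mul_sum] at this
  linarith

/-- The lower bound for the optimal spectral gap. -/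
theorem le_optimalSpectralGap (hV : 2 ≤ Fintype.card V) (G : SimpleGraph V) :
    1 / 27456 * (vertexConductance G ^ 2 / Real.log (Fintype.card V)) ≤ optimalSpectralGap G := by
  have hne : Nonempty V := Fintype.card_pos_iff.1 (by omega)
  have hlog : 0 < Real.log (Fintype.card V) := Real.log_pos (by exact_mod_cast hV)
  obtain ⟨P, hP, hPf⟩ := exists_chain_of_forall_test (G := G)
    (γ := 1 / 27456 * (vertexConductance G ^ 2 / Real.log (Fintype.card V))) (by
      intro m b
      obtain ⟨σ, hσ, hσG, hdom⟩ := exists_dominating_matching G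
        (w := fun x y => ∑ i, (b i x - b i y) ^ 2)
        (fun x y => sum_congr rfl fun i _ => by ring)
        (fun x y => sum_nonneg fun i _ => sq_nonneg _) (fun x => by simp)
      refine ⟨matchingChain σ, matchingChain_mem_chains hσ hσG, ?_⟩
      -- The energy along the matching is a quarter of the sum of `g`, and 27456 = 4 · 6864.
      have h := sq_vertexConductance_mul_sum_centeredSq_le hV G (b := b)
        (fun x => sum_nonneg fun i _ => sq_nonneg (b i x - b i (σ x))) hdom
      simp only [energy_matchingChain, ← mul_sum]
      rw [sum_comm] at h
      have e : 1 / 27456 * (vertexConductance G ^ 2 / Real.log (Fintype.card V))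
            * ∑ i, centeredSq (b i)
          = vertexConductance G ^ 2 * (∑ i, centeredSq (b i))
            / (27456 * Real.log (Fintype.card V)) := by
        field_simp
      rw [e, div_le_iff₀ (by positivity)]
      linarith)
  exact ((le_spectralGap_iff_of_mem_chains hV hP _).2 hPf).trans
    ((isGreatest_optimalSpectralGap hV G).2 ⟨P, hP, rfl⟩)

/-- The upper bound for the optimal spectral gap. -/
theorem optimalSpectralGap_le (hV : 2 ≤ Fintype.card V) (G : SimpleGraph V) :
    optimalSpectralGap G ≤ vertexConductance G := by
  obtain ⟨P, hP, h⟩ := (isGreatest_optimalSpectralGap hV G).1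
  rw [← h]
  exact spectralGap_le_vertexConductance hV hP

/-- Polylogarithmic bounds transfer along polynomial comparisons with logarithmic losses. -/
lemma InvPolylog.of_le {ι : Type*} {n : ι → ℕ} {x y : ι → ℝ} {c : ℝ} (hc : 0 < c)
    (h : ∀ i, 2 ≤ n i → c * (x i ^ 2 / Real.log (n i)) ≤ y i) (hx : InvPolylog n x) :
    InvPolylog n y := by
  obtain ⟨C, k, n₀, hC⟩ := hx
  -- Squaring doubles the exponent, and the logarithmic loss adds one. The maximum with 2 is needed
  -- because the comparison is assumed only for sizes at least 2.
  refine ⟨C ^ 2 / c, 2 * k + 1, max n₀ 2, fun i hi => ?_⟩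
  obtain ⟨hxi, hxC⟩ := hC i (le_of_max_le_left hi)
  have h2 : 2 ≤ n i := le_of_max_le_right hi
  have hlog : 0 < Real.log (n i) := Real.log_pos (by exact_mod_cast h2)
  have hpos : 0 < c * (x i ^ 2 / Real.log (n i)) := by positivity
  refine ⟨hpos.trans_le (h i h2), (one_div_le_one_div_of_le hpos (h i h2)).trans ?_⟩
  have hsq := pow_le_pow_left₀ (by positivity) hxC 2
  have e : 1 / (c * (x i ^ 2 / Real.log (n i))) = (1 / x i) ^ 2 * (Real.log (n i) / c) := by
    field_simp
  rw [e]
  refine (mul_le_mul_of_nonneg_right hsq (by positivity)).trans_eq ?_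
  field_simp
  ring

lemma InvPolylog.mono {ι : Type*} {n : ι → ℕ} {x y : ι → ℝ} (h : ∀ i, 2 ≤ n i → x i ≤ y i)
    (hx : InvPolylog n x) : InvPolylog n y := by
  obtain ⟨C, k, n₀, hC⟩ := hx
  refine ⟨C, k, max n₀ 2, fun i hi => ?_⟩
  obtain ⟨hxi, hxC⟩ := hC i (le_of_max_le_left hi)
  have hxy := h i (le_of_max_le_right hi)
  exact ⟨hxi.trans_le hxy, (one_div_le_one_div_of_le hxi hxy).trans hxC⟩

end

end FastestMixing

end

end

theorem theoremA :
    (∃ c C : ℝ, 0 < c ∧ 0 < C ∧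
      ∀ (V : Type u) [Fintype V] [DecidableEq V] (G : SimpleGraph V), 2 ≤ Fintype.card V →
        IsGreatest
          (FastestMixing.spectralGap '' FastestMixing.chains G (FastestMixing.unif V))
          (FastestMixing.optimalSpectralGap G) ∧
        c * (FastestMixing.vertexConductance G ^ 2 / Real.log (Fintype.card V : ℝ)) ≤
          FastestMixing.optimalSpectralGap G ∧
        FastestMixing.optimalSpectralGap G ≤ C * FastestMixing.vertexConductance G) ∧
    (∀ (ι : Type v) (V : ι → Type u) [∀ i, Fintype (V i)] [∀ i, DecidableEq (V i)]
      (G : ∀ i, SimpleGraph (V i)),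
        FastestMixing.AdmitsFastMixing V G ↔
          FastestMixing.InvPolylog (fun i => Fintype.card (V i))
            (fun i => FastestMixing.vertexConductance (G i))) := by
  refine ⟨⟨1 / 27456, 1, by norm_num, one_pos, ?_⟩, ?_⟩
  · intro V _ _ G hV
    refine ⟨FastestMixing.isGreatest_optimalSpectralGap hV G,
      FastestMixing.le_optimalSpectralGap hV G, ?_⟩
    rw [one_mul]
    exact FastestMixing.optimalSpectralGap_le hV G
  · intro ι V _ _ G
    exact ⟨fun h => FastestMixing.InvPolylog.mono
        (fun i hi => FastestMixing.optimalSpectralGap_le hi (G i)) h,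
      fun h => FastestMixing.InvPolylog.of_le (by norm_num : (0 : ℝ) < 1 / 27456)
        (fun i hi => FastestMixing.le_optimalSpectralGap hi (G i)) h⟩
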